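/- Let $m,n\ge 0$ be integers, let $\|\cdot\|$ be a norm on $\mathbb{R}^m$ with dual norm $\|s\|_*=\sup\{s^\top y:\|y\|\le 1\}$, and let $e=(1,\dots,1)^\top\in\mathbb{R}^m$. Write $\mathbb{R}^m_{++}$ for the set of vectors with positive entries. Let $a^0\in\mathbb{R}^m_{++}$, $A^0=\operatorname{diag}(a^0)$, $\tau,\delta\ge 0$ and $A,V\in\mathbb{R}^{m\times m}$. Put $$Z^0=\bigl\{(y,z)\in\mathbb{R}^m\times\mathbb{R}^m_{++} : z_i-\ln z_i-1\le y_i\ (i=1,\dots,m),\ \|Ay\|\le\tau,\ \|V(z-e)\|\le\delta\bigr\},$$ $$\Omega=\Omega(a^0,\tau,\delta,A,V)=\{A^0z : (y,z)\in Z^0 \text{ for some } y\in\mathbb{R}^m\},$$ and assume that $Z^0$ is compact (this holds, for example, whenever $A$ is non-singular). Let $S\subseteq\mathbb{R}^n$, and let $f_0:\mathbb{R}^m\times\mathbb{R}^n\to(-\infty,+\infty]$ be such that, for every $x\in\mathbb{R}^n$, the function $f_0(\cdot,x)$ is convex and $a^0\in\operatorname{ri}\operatorname{dom}f_0(\cdot,x)$,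 where $\operatorname{dom}f_0(\cdot,x)=\{a: f_0(a,x)<+\infty\}$. Let $f_0^*(v,x)=\sup_{a\in\operatorname{dom}f_0(\cdot,x)}\{v^\top a-f_0(a,x)\}$. Consider the robust problem $$(\mathrm{RC}_{\mathrm{P\,obj}})\qquad \sup_{x\in S}\ \varphi(x),\qquad \varphi(x)=\inf_{a\in\Omega}f_0(a,x),$$ and the problem $$(\mathrm{DRC}_{\mathrm{P\,obj}})\qquad \sup_{x,u,v,w,s^1,s^2}\ \psi(x,u,v,w,s^1,s^2)\quad\text{subject to}\quad x\in S,\ (u,v,w,s^1,s^2)\in D,$$ where $$\psi=-(a^0)^\top v+\sum_{k=1}^m\Bigl\{u_k\ln\Bigl(1-\frac{w_k}{u_k}\Bigr)+w_k\Bigr\}-\tau\|s^1\|_*-\delta\|s^2\|_*-f_0^*(-v,x)$$ and $D$ is the set of all $(u,v,w,s^1,s^2)\in(\mathbb{R}^m)^5$ with $$A^\top s^1=u,\quad w+V^\top s^2=A^0v,\quad u\in\mathbb{R}^m_{++},\quad u-w\in\mathbb{R}^m_{++}.$$ Then the two problems are equivalent in the following sense. 1. For every $x\in\mathbb{R}^n$,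 $\varphi(x)=\sup_{d\in D}\psi(x,d)$. 2. The two problems have the same optimal value (in $[-\infty,+\infty]$). 3. A point $x$ is an optimal solution of $(\mathrm{RC}_{\mathrm{P\,obj}})$ if and only if $x\in S$ and $\sup_{d\in D}\psi(x,d)$ equals the optimal value of $(\mathrm{DRC}_{\mathrm{P\,obj}})$. 4. A point $(x,d)$ is an optimal solution of $(\mathrm{DRC}_{\mathrm{P\,obj}})$ if and only if $x$ is an optimal solution of $(\mathrm{RC}_{\mathrm{P\,obj}})$, $d\in D$ and $\psi(x,d)=\varphi(x)$. 5. For every $x$ for which $f_0(\cdot,x)$ is finite on all of $\mathbb{R}^m$, the infimum defining $\varphi(x)$ is attained. -/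

import Mathlib

open scoped Matrix

noncomputable section

namespace RobustPos

/-- Effective domain of an extended-real-valued function on `ℝ^m`. -/
def effDom {m : ℕ} (g : (Fin m → ℝ) → EReal) : Set (Fin m → ℝ) :=
  {a | g a < ⊤}

/-- Convexity of an extended-real-valued function: its epigraph is a convex set. -/
def IsConvexFun {m : ℕ} (g : (Fin m → ℝ) → EReal) : Prop :=
  Convex ℝ {p : (Fin m → ℝ) × ℝ | g p.1 ≤ (p.2 : EReal)}

/-- Convex conjugate `g^*(v) = sup_{a ∈ dom g} (vᵀ a - g a)`. -/
def conjugate {m : ℕ} (g : (Fin m → ℝ) → EReal) (v : Fin m → ℝ) : EReal :=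
  ⨆ a ∈ effDom g, ((v ⬝ᵥ a : ℝ) : EReal) - g a

/-- Dual norm `‖s‖_* = sup {sᵀ y : ‖y‖ ≤ 1}` of the norm `N`. -/
def dualNorm {m : ℕ} (N : Seminorm ℝ (Fin m → ℝ)) (s : Fin m → ℝ) : ℝ :=
  sSup ((fun y => s ⬝ᵥ y) '' {y | N y ≤ 1})

/-- The set `Z⁰` of pairs `(y, z)` with `z > 0`, `z_i - ln z_i - 1 ≤ y_i`, `‖A y‖ ≤ τ` and
`‖V (z - e)‖ ≤ δ`. -/
def shapeSet {m : ℕ} (N : Seminorm ℝ (Fin m → ℝ)) (τ δ : ℝ) (A V : Matrix (Fin m) (Fin m) ℝ) :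
    Set ((Fin m → ℝ) × (Fin m → ℝ)) :=
  {p | (∀ i, 0 < p.2 i) ∧ (∀ i, p.2 i - Real.log (p.2 i) - 1 ≤ p.1 i) ∧
    N (A *ᵥ p.1) ≤ τ ∧ N (V *ᵥ (p.2 - 1)) ≤ δ}

/-- The uncertainty set `Ω(a⁰, τ, δ, A, V)`: all `a = diag(a⁰) z` with `(y, z) ∈ Z⁰`. -/
def uncertaintySet {m : ℕ} (N : Seminorm ℝ (Fin m → ℝ)) (a0 : Fin m → ℝ) (τ δ : ℝ)
    (A V : Matrix (Fin m) (Fin m) ℝ) : Set (Fin m → ℝ) :=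
  {a | ∃ y z, (y, z) ∈ shapeSet N τ δ A V ∧ a = Matrix.diagonal a0 *ᵥ z}

/-- Objective of the robust problem at `x`: the infimum of `f₀(a, x)` over `a ∈ Ω`. -/
def worstCase {m n : ℕ} (f0 : (Fin m → ℝ) → (Fin n → ℝ) → EReal) (Ω : Set (Fin m → ℝ))
    (x : Fin n → ℝ) : EReal :=
  ⨅ a ∈ Ω, f0 a x

/-- The auxiliary variables of the dual problem. -/
structure DualVars (m : ℕ) where
  u : Fin m → ℝ
  v : Fin m → ℝ
  w : Fin m → ℝ
  s1 : Fin m → ℝ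
  s2 : Fin m → ℝ

/-- The constraints of the dual problem on the auxiliary variables. -/
def dualFeasible {m : ℕ} (a0 : Fin m → ℝ) (A V : Matrix (Fin m) (Fin m) ℝ) :
    Set (DualVars m) :=
  {d | Aᵀ *ᵥ d.s1 = d.u ∧ d.w + Vᵀ *ᵥ d.s2 = Matrix.diagonal a0 *ᵥ d.v ∧
    (∀ k, 0 < d.u k) ∧ (∀ k, 0 < (d.u - d.w) k)}

/-- The objective of the dual problem. -/
def dualObjective {m n : ℕ} (f0 : (Fin m → ℝ) → (Fin n → ℝ) → EReal)
    (N : Seminorm ℝ (Fin m → ℝ)) (a0 : Fin m → ℝ) (τ δ : ℝ)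
    (x : Fin n → ℝ) (d : DualVars m) : EReal :=
  ((-(a0 ⬝ᵥ d.v) + ∑ k, (d.u k * Real.log (1 - d.w k / d.u k) + d.w k)
      - τ * dualNorm N d.s1 - δ * dualNorm N d.s2 : ℝ) : EReal)
    - conjugate (fun a => f0 a x) (-d.v)

/-- `p` is an optimal solution of the problem of maximizing `F` over `C`. -/
def IsOptimal {α : Type*} (F : α → EReal) (C : Set α) (p : α) : Prop :=
  p ∈ C ∧ ∀ q ∈ C, F q ≤ F p

end RobustPos

end

open RobustPos

namespace RobustPos

/-! ### The norm ball and the dual norm -/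

/-! For fixed `x` the core is a zero duality gap for the minimisation of `f0 · x` over the compact
convex set `Ω`; the claims on optimal values and solutions are then order theory. Attainment in `Ω`
holds because finite convex functions on `ℝ^m` are continuous.

Weak duality adds three inequalities: Fenchel–Young for `f0`, the dual norm inequality for the two
norm constraints, and `log t ≤ t - 1`, which yields the conjugate of `z ↦ u (z - ln z - 1)`.

The converse uses two separations. `IsConvexFun.exists_affine_minorant` separates `Ω × {c}` from the
closed epigraph and yields `v`; the relative interior hypothesis at `a0 ∈ Ω` prevents the closure
from dipping below the lower bound on `Ω`. `exists_multipliers` separates an image of the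
exponential constraints from a product of norm balls and yields `s1`, `s2`. That image is closed
because compactness of `Z⁰` gives, by Gordan, a vector `s` with `Aᵀ s > 0`. Moving `s1` slightly
along `s` also makes the constraints on `u` and `u - w` strict, at an arbitrarily small loss: the
supremum is reached in value, without a maximiser. -/

theorem exists_forall_eq_dotProduct {m : ℕ} (L : (Fin m → ℝ) →ₗ[ℝ] ℝ) :
    ∃ s : Fin m → ℝ, ∀ y, L y = s ⬝ᵥ y := by
  refine ⟨fun i => L (Pi.single i 1), fun y => ?_⟩
  rw [L.pi_apply_eq_sum_univ y, dotProduct]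
  refine Finset.sum_congr rfl fun i _ => ?_
  have : (fun j => if i = j then (1 : ℝ) else 0) = Pi.single i 1 := by
    ext j; simp [Pi.single_apply, eq_comm]
  rw [this, smul_eq_mul, mul_comm]

theorem continuous_seminorm {m : ℕ} (N : Seminorm ℝ (Fin m → ℝ)) : Continuous N :=
  (ConvexOn.locallyLipschitz N.convexOn).continuous

theorem exists_pos_mul_norm_le {m : ℕ} {N : Seminorm ℝ (Fin m → ℝ)}
    (hN : ∀ y, N y = 0 → y = 0) : ∃ c > 0, ∀ y, c * ‖y‖ ≤ N y := by
  rcases (Metric.sphere (0 : Fin m → ℝ) 1).eq_empty_or_nonempty with h | h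
  -- The sphere is empty only for `m = 0`, where every vector vanishes.
  · refine ⟨1, one_pos, fun y => ?_⟩
    rcases eq_or_ne y 0 with rfl | hy
    · simp
    · have : ‖y‖⁻¹ • y ∈ Metric.sphere (0 : Fin m → ℝ) 1 := by
        simp [norm_smul, inv_mul_cancel₀ (norm_ne_zero_iff.2 hy)]
      simp [h] at this
  · obtain ⟨y₀, hy₀, hmin⟩ :=
      (isCompact_sphere (0 : Fin m → ℝ) 1).exists_isMinOn h (continuous_seminorm N).continuousOn
    refine ⟨N y₀, ?_, fun y => ?_⟩
    · refine lt_of_le_of_ne (apply_nonneg N _) fun h0 => ?_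
      have := hN y₀ h0.symm
      simp [this] at hy₀
    · rcases eq_or_ne y 0 with rfl | hy
      · simp
      · have hn : 0 < ‖y‖ := norm_pos_iff.2 hy
        have : ‖y‖⁻¹ • y ∈ Metric.sphere (0 : Fin m → ℝ) 1 := by
          simp [norm_smul, inv_mul_cancel₀ hn.ne']
        have h1 : N y₀ ≤ N (‖y‖⁻¹ • y) := hmin this
        rw [map_smul_eq_mul, norm_inv, norm_norm] at h1
        calc N y₀ * ‖y‖ ≤ ‖y‖⁻¹ * N y * ‖y‖ := by gcongr
          _ = N y := by field_simp

theorem isCompact_setOf_seminorm_le {m : ℕ} {N : Seminorm ℝ (Fin m → ℝ)}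
    (hN : ∀ y, N y = 0 → y = 0) (r : ℝ) : IsCompact {y | N y ≤ r} := by
  obtain ⟨c, hc, h⟩ := exists_pos_mul_norm_le hN
  refine Metric.isCompact_of_isClosed_isBounded
    (isClosed_le (continuous_seminorm N) continuous_const) ?_
  refine isBounded_iff_forall_norm_le.2 ⟨r / c, fun y hy => ?_⟩
  rw [le_div_iff₀ hc, mul_comm]
  exact (h y).trans hy

theorem convex_setOf_seminorm_le {m : ℕ} (N : Seminorm ℝ (Fin m → ℝ)) (r : ℝ) :
    Convex ℝ {y | N y ≤ r} := by
  simpa using N.convexOn.convex_le r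

theorem continuous_dotProduct_right {m : ℕ} (s : Fin m → ℝ) :
    Continuous fun y : Fin m → ℝ => s ⬝ᵥ y := by
  unfold dotProduct; fun_prop

theorem bddAbove_dualNorm {m : ℕ} {N : Seminorm ℝ (Fin m → ℝ)}
    (hN : ∀ y, N y = 0 → y = 0) (s : Fin m → ℝ) :
    BddAbove ((fun y => s ⬝ᵥ y) '' {y | N y ≤ 1}) :=
  ((isCompact_setOf_seminorm_le hN 1).image (continuous_dotProduct_right s)).bddAbove

theorem dotProduct_le_mul_dualNorm {m : ℕ} {N : Seminorm ℝ (Fin m → ℝ)}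
    (hN : ∀ y, N y = 0 → y = 0) (s y : Fin m → ℝ) {r : ℝ} (hr : 0 ≤ r) (hy : N y ≤ r) :
    s ⬝ᵥ y ≤ r * dualNorm N s := by
  rcases hr.eq_or_lt with rfl | hr
  · have : y = 0 := hN y (le_antisymm hy (apply_nonneg N y))
    simp [this]
  · have h1 : s ⬝ᵥ (r⁻¹ • y) ≤ dualNorm N s := by
      refine le_csSup (bddAbove_dualNorm hN s) ⟨r⁻¹ • y, ?_, rfl⟩
      have : r⁻¹ * N y ≤ r⁻¹ * r := by gcongr
      rw [inv_mul_cancel₀ hr.ne'] at this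
      simpa [map_smul_eq_mul, abs_of_pos hr] using this
    rw [dotProduct_smul, smul_eq_mul] at h1
    calc s ⬝ᵥ y = r * (r⁻¹ * s ⬝ᵥ y) := by field_simp
      _ ≤ r * dualNorm N s := by gcongr

theorem dualNorm_le {m : ℕ} {N : Seminorm ℝ (Fin m → ℝ)} {s : Fin m → ℝ} {κ : ℝ}
    (h : ∀ y, N y ≤ 1 → s ⬝ᵥ y ≤ κ) : dualNorm N s ≤ κ := by
  refine csSup_le ⟨_, 0, by simp, rfl⟩ ?_
  rintro _ ⟨y, hy, rfl⟩
  exact h y hy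

theorem mul_dualNorm_le {m : ℕ} {N : Seminorm ℝ (Fin m → ℝ)} {s : Fin m → ℝ} {r κ : ℝ}
    (hr : 0 ≤ r) (h : ∀ y, N y ≤ r → s ⬝ᵥ y ≤ κ) : r * dualNorm N s ≤ κ := by
  rcases hr.eq_or_lt with rfl | hr
  · simpa using h 0 (by simp)
  · rw [mul_comm, ← le_div_iff₀ hr]
    refine dualNorm_le fun y hy => ?_
    rw [le_div_iff₀ hr, mul_comm, ← smul_eq_mul, ← dotProduct_smul]
    refine h _ ?_
    rw [map_smul_eq_mul, Real.norm_of_nonneg hr.le]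
    exact mul_le_of_le_one_right hr.le hy

theorem dualNorm_add_smul_le {m : ℕ} {N : Seminorm ℝ (Fin m → ℝ)}
    (hN : ∀ y, N y = 0 → y = 0) (s t : Fin m → ℝ) {ε : ℝ} (hε : 0 ≤ ε) :
    dualNorm N (s + ε • t) ≤ dualNorm N s + ε * dualNorm N t := by
  refine dualNorm_le fun y hy => ?_
  have h1 := dotProduct_le_mul_dualNorm hN s y zero_le_one hy
  have h2 := mul_le_mul_of_nonneg_left (dotProduct_le_mul_dualNorm hN t y zero_le_one hy) hε
  rw [add_dotProduct, smul_dotProduct, smul_eq_mul]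
  linarith

/-! ### The set `Z⁰` -/

/-- The pairs `(y, z)` with `z > 0` and `z_i - ln z_i - 1 ≤ y_i`, in exponential form. -/
def expSet (m : ℕ) : Set ((Fin m → ℝ) × (Fin m → ℝ)) :=
  {p | ∀ i, Real.exp (p.2 i - 1 - p.1 i) ≤ p.2 i}

/-- The exponential form absorbs the open condition `z > 0`, so closedness and convexity follow from
those of `exp`. -/
theorem exp_sub_le_iff {y z : ℝ} :
    Real.exp (z - 1 - y) ≤ z ↔ 0 < z ∧ z - Real.log z - 1 ≤ y := by
  constructor
  · intro h
    have hz : 0 < z := (Real.exp_pos _).trans_le h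
    have := (Real.le_log_iff_exp_le hz).2 h
    exact ⟨hz, by linarith⟩
  · rintro ⟨hz, h⟩
    exact (Real.le_log_iff_exp_le hz).1 (by linarith)

theorem mem_expSet_iff {m : ℕ} {p : (Fin m → ℝ) × (Fin m → ℝ)} :
    p ∈ expSet m ↔ (∀ i, 0 < p.2 i) ∧ ∀ i, p.2 i - Real.log (p.2 i) - 1 ≤ p.1 i := by
  simp only [expSet, Set.mem_ofPred_eq, exp_sub_le_iff, forall_and]

theorem mem_shapeSet_iff {m : ℕ} {N : Seminorm ℝ (Fin m → ℝ)} {τ δ : ℝ}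
    {A V : Matrix (Fin m) (Fin m) ℝ} {p : (Fin m → ℝ) × (Fin m → ℝ)} :
    p ∈ shapeSet N τ δ A V ↔
      p ∈ expSet m ∧ N (A *ᵥ p.1) ≤ τ ∧ N (V *ᵥ (p.2 - 1)) ≤ δ := by
  rw [mem_expSet_iff, shapeSet, Set.mem_ofPred_eq, and_assoc]

theorem isClosed_expSet (m : ℕ) : IsClosed (expSet m) := by
  simp only [expSet, Set.ofPred_forall]
  exact isClosed_iInter fun i => isClosed_le (by fun_prop) (by fun_prop)

theorem convex_expSet (m : ℕ) : Convex ℝ (expSet m) := by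
  intro p hp q hq a b ha hb hab i
  have hp := hp i
  have hq := hq i
  have h := convexOn_exp.2 (Set.mem_univ (p.2 i - 1 - p.1 i)) (Set.mem_univ (q.2 i - 1 - q.1 i))
    ha hb hab
  have e : (a • p + b • q).2 i - 1 - (a • p + b • q).1 i =
      a • (p.2 i - 1 - p.1 i) + b • (q.2 i - 1 - q.1 i) := by
    simp only [Prod.snd_add, Prod.smul_snd, Prod.fst_add, Prod.smul_fst, Pi.add_apply,
      Pi.smul_apply, smul_eq_mul]
    linear_combination -(1 : ℝ) * (hab.symm)
  rw [e]
  refine h.trans ?_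
  simp only [Prod.snd_add, Prod.smul_snd, Pi.add_apply, Pi.smul_apply, smul_eq_mul]
  gcongr

theorem sub_log_sub_one_nonneg {z : ℝ} (hz : 0 < z) : 0 ≤ z - Real.log z - 1 := by
  linarith [Real.log_le_sub_one_of_pos hz]

theorem expSet_fst_nonneg {m : ℕ} {p : (Fin m → ℝ) × (Fin m → ℝ)} (hp : p ∈ expSet m) (i : Fin m) :
    0 ≤ p.1 i := by
  rw [mem_expSet_iff] at hp
  exact (sub_log_sub_one_nonneg (hp.1 i)).trans (hp.2 i)

/-- Applying `log t ≤ t - 1` at `t = z / 2` gives `z ≤ 2 y + 2 log 2`. Thus a bound on `y` bounds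
`z`. -/
theorem expSet_snd_le {m : ℕ} {p : (Fin m → ℝ) × (Fin m → ℝ)} (hp : p ∈ expSet m) (i : Fin m) :
    p.2 i ≤ 2 * p.1 i + 2 := by
  rw [mem_expSet_iff] at hp
  have hz := hp.1 i
  have h1 := Real.log_le_sub_one_of_pos (half_pos hz)
  rw [Real.log_div hz.ne' two_ne_zero] at h1
  have h2 := Real.log_two_lt_d9
  have := hp.2 i
  linarith

theorem zero_one_mem_expSet (m : ℕ) : ((0 : Fin m → ℝ), (1 : Fin m → ℝ)) ∈ expSet m := by
  intro i; simp

theorem zero_one_mem_shapeSet {m : ℕ} (N : Seminorm ℝ (Fin m → ℝ)) {τ δ : ℝ} (hτ : 0 ≤ τ)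
    (hδ : 0 ≤ δ) (A V : Matrix (Fin m) (Fin m) ℝ) :
    ((0 : Fin m → ℝ), (1 : Fin m → ℝ)) ∈ shapeSet N τ δ A V := by
  rw [mem_shapeSet_iff]
  exact ⟨zero_one_mem_expSet m, by simpa, by simpa⟩

theorem convex_shapeSet {m : ℕ} (N : Seminorm ℝ (Fin m → ℝ)) (τ δ : ℝ)
    (A V : Matrix (Fin m) (Fin m) ℝ) : Convex ℝ (shapeSet N τ δ A V) := by
  intro p hp q hq a b ha hb hab
  rw [mem_shapeSet_iff] at *
  refine ⟨convex_expSet m hp.1 hq.1 ha hb hab, ?_, ?_⟩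
  · have := convex_setOf_seminorm_le N τ hp.2.1 hq.2.1 ha hb hab
    simpa [Matrix.mulVec_add, Matrix.mulVec_smul] using this
  · have := convex_setOf_seminorm_le N δ hp.2.2 hq.2.2 ha hb hab
    have e : (a • p + b • q).2 - 1 = a • (p.2 - 1) + b • (q.2 - 1) := by
      ext i
      simp only [Prod.snd_add, Prod.smul_snd, Pi.add_apply, Pi.smul_apply, smul_eq_mul,
        Pi.sub_apply, Pi.one_apply]
      linear_combination -(1 : ℝ) * (hab.symm)
    rw [e, Matrix.mulVec_add, Matrix.mulVec_smul, Matrix.mulVec_smul]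
    exact this

/-- Otherwise the ray `(t y, 1)`, `t ≥ 0`, would be an unbounded part of `Z⁰`. -/
theorem eq_zero_of_isCompact_shapeSet {m : ℕ} {N : Seminorm ℝ (Fin m → ℝ)} {τ δ : ℝ} (hτ : 0 ≤ τ)
    (hδ : 0 ≤ δ) {A V : Matrix (Fin m) (Fin m) ℝ} (hZ : IsCompact (shapeSet N τ δ A V))
    {y : Fin m → ℝ} (hy : ∀ i, 0 ≤ y i) (hAy : A *ᵥ y = 0) : y = 0 := by
  obtain ⟨C, hC⟩ := hZ.isBounded.exists_norm_le
  have hmem : ∀ t : ℝ, 0 ≤ t → (t • y, (1 : Fin m → ℝ)) ∈ shapeSet N τ δ A V := by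
    intro t ht
    rw [mem_shapeSet_iff, mem_expSet_iff]
    refine ⟨⟨by simp, fun i => ?_⟩, ?_, by simpa⟩
    · simpa using mul_nonneg ht (hy i)
    · simpa [Matrix.mulVec_smul, hAy]
  by_contra hne
  have hn : 0 < ‖y‖ := norm_pos_iff.2 hne
  have hC0 : 0 ≤ C := (norm_nonneg _).trans (hC _ (hmem 0 le_rfl))
  have h1 := hC _ (hmem ((C + 1) / ‖y‖) (by positivity))
  have h2 : ‖((C + 1) / ‖y‖) • y‖ ≤ C := (norm_fst_le _).trans h1
  rw [norm_smul, Real.norm_of_nonneg (by positivity), div_mul_cancel₀ _ hn.ne'] at h2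
  linarith

/-- Gordan's theorem of the alternative. -/
theorem exists_transpose_mulVec_pos {m : ℕ} {A : Matrix (Fin m) (Fin m) ℝ}
    (h : ∀ y : Fin m → ℝ, (∀ i, 0 ≤ y i) → A *ᵥ y = 0 → y = 0) :
    ∃ s : Fin m → ℝ, ∀ i, 0 < (Aᵀ *ᵥ s) i := by
  have hK : IsCompact (A.mulVecLin '' stdSimplex ℝ (Fin m)) :=
    (isCompact_stdSimplex ℝ (Fin m)).image A.mulVecLin.continuous_of_finiteDimensional
  have hconv : Convex ℝ (A.mulVecLin '' stdSimplex ℝ (Fin m)) :=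
    (convex_stdSimplex ℝ (Fin m)).linear_image _
  have h0 : (0 : Fin m → ℝ) ∉ A.mulVecLin '' stdSimplex ℝ (Fin m) := by
    rintro ⟨y, hy, hy0⟩
    have := h y hy.1 (by simpa using hy0)
    have h1 := hy.2
    simp [this] at h1
  -- A functional positive on the image of the simplex is positive at its vertices, that is, on the
  -- columns of `A`.
  obtain ⟨f, c, hc, hf⟩ := geometric_hahn_banach_point_closed hconv hK.isClosed h0
  obtain ⟨s, hs⟩ := exists_forall_eq_dotProduct (f : (Fin m → ℝ) →ₗ[ℝ] ℝ)
  refine ⟨s, fun i => ?_⟩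
  have h1 := hf _ ⟨Pi.single i 1, single_mem_stdSimplex ℝ i, rfl⟩
  rw [map_zero] at hc
  have h2 := hs (A *ᵥ Pi.single i 1)
  rw [Matrix.dotProduct_mulVec, dotProduct_single_one] at h2
  rw [Matrix.mulVec_transpose]
  have h3 : 0 < f (A *ᵥ Pi.single i 1) := hc.trans h1
  exact h2 ▸ h3

/-! ### Support function duality for `Z⁰` -/

/-- Young's inequality for the conjugate of `z ↦ u (z - ln z - 1)`. -/
theorem mul_sub_one_le {u w z : ℝ} (hu : 0 < u) (huw : 0 < u - w) (hz : 0 < z) :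
    w * (z - 1) ≤ u * (z - Real.log z - 1) - (u * Real.log (1 - w / u) + w) := by
  have hq : 0 < 1 - w / u := by rw [sub_pos, div_lt_one hu]; linarith
  -- Tangent inequality at `t = z (1 - w / u)`, to be scaled by `u`; equality holds at `z = u / (u -
  -- w)`.
  have h := Real.log_le_sub_one_of_pos (mul_pos hz hq)
  rw [Real.log_mul hz.ne' hq.ne'] at h
  have h' := mul_le_mul_of_nonneg_left h hu.le
  have e : u * (z * (1 - w / u) - 1) = u * z - w * z - u := by field_simp
  rw [e] at h'
  linarith

/-- The equality case of `mul_sub_one_le`, at its maximiser `z = u / (u - w)`. -/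
theorem mul_div_sub_one_eq {u w : ℝ} (hu : 0 < u) (huw : 0 < u - w) :
    w * (u / (u - w) - 1) - u * (u / (u - w) - Real.log (u / (u - w)) - 1) =
      -(u * Real.log (1 - w / u) + w) := by
  have e : 1 - w / u = (u / (u - w))⁻¹ := by rw [inv_div]; field_simp
  rw [e, Real.log_inv]
  have : u / (u - w) * (u - w) = u := div_mul_cancel₀ _ huw.ne'
  linear_combination -this

theorem dotProduct_le_dual_bound {m : ℕ} {N : Seminorm ℝ (Fin m → ℝ)}
    (hN : ∀ y, N y = 0 → y = 0) {τ δ : ℝ} (hτ : 0 ≤ τ) (hδ : 0 ≤ δ)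
    {A V : Matrix (Fin m) (Fin m) ℝ} {u w s1 s2 : Fin m → ℝ} (hu : Aᵀ *ᵥ s1 = u)
    (hupos : ∀ k, 0 < u k) (huw : ∀ k, 0 < (u - w) k)
    {y z : Fin m → ℝ} (h : (y, z) ∈ shapeSet N τ δ A V) :
    (w + Vᵀ *ᵥ s2) ⬝ᵥ (z - 1) ≤
      -(∑ k, (u k * Real.log (1 - w k / u k) + w k)) + τ * dualNorm N s1 + δ * dualNorm N s2 := by
  obtain ⟨hz, hyz, hA, hV⟩ := h
  simp only at hz hyz hA hV
  have h1 := dotProduct_le_mul_dualNorm hN s1 _ hτ hA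
  have h2 := dotProduct_le_mul_dualNorm hN s2 _ hδ hV
  rw [Matrix.dotProduct_mulVec, ← Matrix.mulVec_transpose] at h1 h2
  rw [hu] at h1
  have h3 : w ⬝ᵥ (z - 1) ≤ u ⬝ᵥ y - ∑ k, (u k * Real.log (1 - w k / u k) + w k) := by
    simp only [dotProduct]
    rw [← Finset.sum_sub_distrib]
    refine Finset.sum_le_sum fun k _ => ?_
    have := mul_sub_one_le (hupos k) (huw k) (hz k)
    have h4 := mul_le_mul_of_nonneg_left (hyz k) (hupos k).le
    simp only [Pi.sub_apply, Pi.one_apply]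
    linarith
  rw [add_dotProduct]
  linarith

/-- The image of `expSet` under `(y, z) ↦ (A y, V (z - 1))`, with the hypograph of `z ↦ pᵀ z`. -/
def valueSet {m : ℕ} (A V : Matrix (Fin m) (Fin m) ℝ) (p : Fin m → ℝ) :
    Set ((Fin m → ℝ) × (Fin m → ℝ) × ℝ) :=
  {q | ∃ y z, (y, z) ∈ expSet m ∧ A *ᵥ y = q.1 ∧ V *ᵥ (z - 1) = q.2.1 ∧ q.2.2 ≤ p ⬝ᵥ z}

theorem convex_valueSet {m : ℕ} (A V : Matrix (Fin m) (Fin m) ℝ) (p : Fin m → ℝ) :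
    Convex ℝ (valueSet A V p) := by
  rintro ⟨q1, q2, q3⟩ ⟨y, z, hyz, h1, h2, h3⟩ ⟨r1, r2, r3⟩ ⟨y', z', hyz', h1', h2', h3'⟩ a b ha hb hab
  refine ⟨a • y + b • y', a • z + b • z', convex_expSet m hyz hyz' ha hb hab, ?_, ?_, ?_⟩
  · simp only [Matrix.mulVec_add, Matrix.mulVec_smul, h1, h1', Prod.fst_add, Prod.smul_fst]
  · have e : a • z + b • z' - 1 = a • (z - 1) + b • (z' - 1) := by
      ext i
      simp only [Pi.add_apply, Pi.smul_apply, smul_eq_mul, Pi.sub_apply, Pi.one_apply]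
      linear_combination -(1 : ℝ) * (hab.symm)
    simp only [e, Matrix.mulVec_add, Matrix.mulVec_smul, h2, h2', Prod.snd_add, Prod.smul_snd,
      Prod.fst_add, Prod.smul_fst]
  · simp only [Prod.snd_add, Prod.smul_snd, dotProduct_add, dotProduct_smul, smul_eq_mul]
    simp only at h3 h3'
    gcongr

/-- Since `y ≥ 0` and `Aᵀ s > 0`, a bound on `sᵀ A y` bounds every `y i`, hence every `z i`;
preimages of a convergent sequence then have a convergent subsequence. -/
theorem isClosed_valueSet {m : ℕ} {A : Matrix (Fin m) (Fin m) ℝ} (V : Matrix (Fin m) (Fin m) ℝ)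
    (p : Fin m → ℝ) {s : Fin m → ℝ} (hs : ∀ i, 0 < (Aᵀ *ᵥ s) i) :
    IsClosed (valueSet A V p) := by
  refine IsSeqClosed.isClosed ?_
  intro q ql hq hlim
  choose y z hyz hA hV hp using hq
  have hlim1 : Filter.Tendsto (fun k => (q k).1) Filter.atTop (nhds ql.1) :=
    (continuous_fst.tendsto _).comp hlim
  have hlim2 : Filter.Tendsto (fun k => (q k).2.1) Filter.atTop (nhds ql.2.1) :=
    ((continuous_fst.comp continuous_snd).tendsto _).comp hlim
  have hlim3 : Filter.Tendsto (fun k => (q k).2.2) Filter.atTop (nhds ql.2.2) :=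
    ((continuous_snd.comp continuous_snd).tendsto _).comp hlim
  obtain ⟨R, hR⟩ := (((continuous_dotProduct_right s).tendsto _).comp hlim1).bddAbove_range
  have hyb : ∀ k i, y k i ≤ R / (Aᵀ *ᵥ s) i := by
    intro k i
    rw [le_div_iff₀ (hs i)]
    have h1 : s ⬝ᵥ (q k).1 ≤ R := hR ⟨k, rfl⟩
    rw [← hA k, Matrix.dotProduct_mulVec, ← Matrix.mulVec_transpose] at h1
    refine le_trans ?_ h1
    rw [mul_comm]
    exact Finset.single_le_sum (f := fun i => (Aᵀ *ᵥ s) i * y k i)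
      (fun j _ => mul_nonneg (hs j).le (expSet_fst_nonneg (hyz k) j)) (Finset.mem_univ i)
  have hbox : ∀ k, (y k, z k) ∈
      Set.Icc (0 : Fin m → ℝ) (fun i => R / (Aᵀ *ᵥ s) i) ×ˢ
        Set.Icc (0 : Fin m → ℝ) (fun i => 2 * (R / (Aᵀ *ᵥ s) i) + 2) := by
    intro k
    refine ⟨⟨fun i => expSet_fst_nonneg (hyz k) i, fun i => hyb k i⟩,
      ⟨fun i => ((mem_expSet_iff.1 (hyz k)).1 i).le, fun i => ?_⟩⟩
    have h1 := expSet_snd_le (hyz k) i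
    have h2 := hyb k i
    simp only at h1 ⊢
    linarith
  obtain ⟨⟨y', z'⟩, -, φ, hφ, hφlim⟩ :=
    (isCompact_Icc.prod isCompact_Icc).tendsto_subseq hbox
  have hy' : Filter.Tendsto (fun k => y (φ k)) Filter.atTop (nhds y') :=
    (continuous_fst.tendsto _).comp hφlim
  have hz' : Filter.Tendsto (fun k => z (φ k)) Filter.atTop (nhds z') :=
    (continuous_snd.tendsto _).comp hφlim
  refine ⟨y', z', (isClosed_expSet m).mem_of_tendsto hφlim
    (Filter.Eventually.of_forall fun k => hyz (φ k)), ?_, ?_, ?_⟩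
  · refine tendsto_nhds_unique (f := fun k => A *ᵥ y (φ k)) (l := Filter.atTop)
      (((Continuous.matrix_mulVec continuous_const continuous_id).tendsto y').comp hy') ?_
    simp only [hA]
    exact hlim1.comp hφ.tendsto_atTop
  · refine tendsto_nhds_unique (f := fun k => V *ᵥ (z (φ k) - 1)) (l := Filter.atTop)
      (((Continuous.matrix_mulVec continuous_const
        (continuous_id.sub continuous_const)).tendsto z').comp hz') ?_
    simp only [hV]
    exact hlim2.comp hφ.tendsto_atTop
  · exact le_of_tendsto_of_tendsto' (hlim3.comp hφ.tendsto_atTop)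
      (((continuous_dotProduct_right p).tendsto z').comp hz') fun k => hp (φ k)

/-- Lagrange multipliers for the maximization of `pᵀ z` over `Z⁰`. -/
theorem exists_multipliers {m : ℕ} {N : Seminorm ℝ (Fin m → ℝ)}
    (hN : ∀ y, N y = 0 → y = 0) {τ δ : ℝ} (hτ : 0 ≤ τ) (hδ : 0 ≤ δ)
    {A V : Matrix (Fin m) (Fin m) ℝ} {s : Fin m → ℝ} (hs : ∀ i, 0 < (Aᵀ *ᵥ s) i)
    {p : Fin m → ℝ} {η : ℝ} (hη : ∀ y z, (y, z) ∈ shapeSet N τ δ A V → p ⬝ᵥ z < η) :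
    ∃ s1 s2 : Fin m → ℝ, ∀ y z, (y, z) ∈ expSet m →
      p ⬝ᵥ z - (Aᵀ *ᵥ s1) ⬝ᵥ y - (Vᵀ *ᵥ s2) ⬝ᵥ (z - 1) ≤
        η - τ * dualNorm N s1 - δ * dualNorm N s2 := by
  have hdisj : Disjoint (valueSet A V p) ({b | N b ≤ τ} ×ˢ {b | N b ≤ δ} ×ˢ {η}) := by
    rw [Set.disjoint_left]
    rintro ⟨q1, q2, q3⟩ ⟨y, z, hyz, rfl, rfl, h3⟩ ⟨hb1, hb2, hb3⟩
    obtain rfl : q3 = η := hb3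
    exact absurd (hη y z (mem_shapeSet_iff.2 ⟨hyz, hb1, hb2⟩)) (not_lt.2 h3)
  obtain ⟨f, α, β, hf1, hαβ, hf2⟩ := geometric_hahn_banach_closed_compact
    (convex_valueSet A V p) (isClosed_valueSet V p hs)
    ((convex_setOf_seminorm_le N τ).prod
      ((convex_setOf_seminorm_le N δ).prod (convex_singleton η)))
    ((isCompact_setOf_seminorm_le hN τ).prod
      ((isCompact_setOf_seminorm_le hN δ).prod isCompact_singleton)) hdisj
  obtain ⟨t1, ht1⟩ := exists_forall_eq_dotProduct
    ((f : _ →ₗ[ℝ] ℝ) ∘ₗ LinearMap.inl ℝ (Fin m → ℝ) ((Fin m → ℝ) × ℝ))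
  obtain ⟨t2, ht2⟩ := exists_forall_eq_dotProduct
    ((f : _ →ₗ[ℝ] ℝ) ∘ₗ LinearMap.inr ℝ (Fin m → ℝ) ((Fin m → ℝ) × ℝ) ∘ₗ
      LinearMap.inl ℝ (Fin m → ℝ) ℝ)
  set μ : ℝ := f (0, 0, 1) with hμ
  have hf : ∀ b1 b2 r, f (b1, b2, r) = t1 ⬝ᵥ b1 + t2 ⬝ᵥ b2 + μ * r := by
    intro b1 b2 r
    rw [← ht1, ← ht2]
    have : ((b1, b2, r) : (Fin m → ℝ) × (Fin m → ℝ) × ℝ) =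
        (b1, 0, 0) + (0, b2, 0) + r • (0, 0, 1) := by simp
    rw [this, map_add, map_add, map_smul, ← hμ, smul_eq_mul, mul_comm]
    rfl
  have hpt : ∀ r ≤ p ⬝ᵥ (1 : Fin m → ℝ), μ * r < α := by
    intro r hr
    have := hf1 (0, 0, r) ⟨0, 1, zero_one_mem_expSet m, by simp, by simp, hr⟩
    simpa [hf] using this
  have hb0 : β < μ * η := by
    have := hf2 (0, 0, η) ⟨by simpa, by simpa, rfl⟩
    simpa [hf] using this
  -- The point `(0, 1)` of `Z⁰` acts as a Slater point: both separated sets meet the line over the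
  -- origin, at heights `pᵀ 1 < η`, so the hyperplane is not vertical.
  have hμpos : 0 < μ := by
    have h1 : p ⬝ᵥ (1 : Fin m → ℝ) < η := hη 0 1 (zero_one_mem_shapeSet N hτ hδ A V)
    have h2 := hpt _ le_rfl
    by_contra hle
    push Not at hle
    nlinarith
  refine ⟨-(μ⁻¹ • t1), -(μ⁻¹ • t2), fun y z hyz => ?_⟩
  have hval : t1 ⬝ᵥ (A *ᵥ y) + t2 ⬝ᵥ (V *ᵥ (z - 1)) + μ * (p ⬝ᵥ z) < α := by
    rw [← hf]
    exact hf1 _ ⟨y, z, hyz, rfl, rfl, le_rfl⟩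
  have hb : ∀ b1, N b1 ≤ τ → ∀ b2, N b2 ≤ δ → α < t1 ⬝ᵥ b1 + t2 ⬝ᵥ b2 + μ * η := by
    intro b1 h1 b2 h2
    rw [← hf]
    exact hαβ.trans (hf2 _ ⟨h1, h2, rfl⟩)
  have key1 : τ * dualNorm N (-(μ⁻¹ • t1)) ≤
      η - μ⁻¹ * α - δ * dualNorm N (-(μ⁻¹ • t2)) := by
    -- The two balls are independent: with `b1` fixed, the supremum over `b2` is taken, then the one
    -- over `b1`.
    refine mul_dualNorm_le hτ fun b1 h1 => ?_
    have : δ * dualNorm N (-(μ⁻¹ • t2)) ≤ η - μ⁻¹ * α - (-(μ⁻¹ • t1)) ⬝ᵥ b1 := by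
      refine mul_dualNorm_le hδ fun b2 h2 => ?_
      have h3 := mul_le_mul_of_nonneg_left (hb b1 h1 b2 h2).le (inv_pos.2 hμpos).le
      simp only [neg_dotProduct, smul_dotProduct, smul_eq_mul]
      have : μ⁻¹ * (μ * η) = η := inv_mul_cancel_left₀ hμpos.ne' η
      linarith
    linarith
  have h3 := mul_le_mul_of_nonneg_left hval.le (inv_pos.2 hμpos).le
  have h4 : μ⁻¹ * (μ * (p ⬝ᵥ z)) = p ⬝ᵥ z := inv_mul_cancel_left₀ hμpos.ne' _
  rw [Matrix.mulVec_transpose, Matrix.mulVec_transpose, ← Matrix.dotProduct_mulVec,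
    ← Matrix.dotProduct_mulVec]
  simp only [neg_dotProduct, smul_dotProduct, smul_eq_mul]
  linarith


/-- Letting `y → ∞` at `z = 1` forces `u ≥ 0`. Letting `z → ∞` on the curve `y = z - ln z - 1`
forces `w ≤ u`, the term `u ln z` being nonnegative. -/
theorem nonneg_and_le_of_forall_le {u w B : ℝ}
    (h : ∀ y z : ℝ, 0 < z → z - Real.log z - 1 ≤ y → w * (z - 1) - u * y ≤ B) :
    0 ≤ u ∧ w ≤ u := by
  have hB : B ≤ |B| := le_abs_self B
  have hB0 : 0 ≤ |B| := abs_nonneg B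
  have hu : 0 ≤ u := by
    by_contra hu
    push Not at hu
    have hpos : 0 < -u := by linarith
    have h1 := h ((|B| + 1) / -u) 1 one_pos (by
      simp only [Real.log_one, sub_zero, sub_self]; positivity)
    have h2 : (|B| + 1) / -u * -u = |B| + 1 := div_mul_cancel₀ _ hpos.ne'
    linarith
  refine ⟨hu, ?_⟩
  by_contra hw
  push Not at hw
  have hpos : 0 < w - u := by linarith
  set t := (|B| + 1) / (w - u) with ht
  have ht0 : 0 ≤ t := by positivity
  have h1 := h (1 + t - Real.log (1 + t) - 1) (1 + t) (by linarith) le_rfl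
  have h2 : t * (w - u) = |B| + 1 := div_mul_cancel₀ _ hpos.ne'
  have h3 := mul_nonneg hu (Real.log_nonneg (show (1 : ℝ) ≤ 1 + t by linarith))
  linarith

theorem dualNorm_nonneg {m : ℕ} {N : Seminorm ℝ (Fin m → ℝ)}
    (hN : ∀ y, N y = 0 → y = 0) (s : Fin m → ℝ) : 0 ≤ dualNorm N s := by
  simpa using dotProduct_le_mul_dualNorm hN s 0 zero_le_one (by simp)

/-- Approximate strong duality for the support function of `Z⁰`. -/
theorem exists_dual_bound_le {m : ℕ} {N : Seminorm ℝ (Fin m → ℝ)}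
    (hN : ∀ y, N y = 0 → y = 0) {τ δ : ℝ} (hτ : 0 ≤ τ) (hδ : 0 ≤ δ)
    {A V : Matrix (Fin m) (Fin m) ℝ} {s : Fin m → ℝ} (hs : ∀ i, 0 < (Aᵀ *ᵥ s) i)
    {p : Fin m → ℝ} {η η' : ℝ} (hη : ∀ y z, (y, z) ∈ shapeSet N τ δ A V → p ⬝ᵥ z < η)
    (hηη' : η < η') :
    ∃ u w s1 s2 : Fin m → ℝ, Aᵀ *ᵥ s1 = u ∧ w + Vᵀ *ᵥ s2 = p ∧ (∀ k, 0 < u k) ∧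
      (∀ k, 0 < (u - w) k) ∧
      p ⬝ᵥ 1 - ∑ k, (u k * Real.log (1 - w k / u k) + w k) +
        τ * dualNorm N s1 + δ * dualNorm N s2 ≤ η' := by
  obtain ⟨s1, s2, hbound⟩ := exists_multipliers hN hτ hδ hs hη
  set w := p - Vᵀ *ᵥ s2 with hw
  have hbound' : ∀ y z, (y, z) ∈ expSet m → p ⬝ᵥ 1 + w ⬝ᵥ (z - 1) - (Aᵀ *ᵥ s1) ⬝ᵥ y ≤
      η - τ * dualNorm N s1 - δ * dualNorm N s2 := by
    intro y z hyz
    have h1 := hbound y z hyz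
    have h2 : p ⬝ᵥ 1 + w ⬝ᵥ (z - 1) = p ⬝ᵥ z - (Vᵀ *ᵥ s2) ⬝ᵥ (z - 1) := by
      rw [hw, sub_dotProduct, dotProduct_sub p]; ring
    linarith
  have hcoord : ∀ i, 0 ≤ (Aᵀ *ᵥ s1) i ∧ w i ≤ (Aᵀ *ᵥ s1) i := by
    intro i
    refine nonneg_and_le_of_forall_le
      (B := η - τ * dualNorm N s1 - δ * dualNorm N s2 - p ⬝ᵥ 1) fun y z hz hyz => ?_
    -- Only coordinate `i` of `(0, 1)` is changed, which isolates one scalar inequality.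
    have h1 := hbound' (Pi.single i y) (1 + Pi.single i (z - 1)) ?_
    · rw [add_sub_cancel_left, dotProduct_single, dotProduct_single] at h1
      linarith
    · rw [mem_expSet_iff, ← forall_and]
      intro j
      rcases eq_or_ne j i with rfl | hj
      · simp only [Pi.add_apply, Pi.one_apply, Pi.single_eq_same, add_sub_cancel]
        exact ⟨hz, hyz⟩
      · simp [hj]
  have hs0 := dualNorm_nonneg hN s
  have hden : 0 < τ * dualNorm N s + 1 := by positivity
  -- The shift by `ε • s` costs at most `τ ε ‖s‖_*`, kept below `η' - η`; the `+ 1` avoids a zero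
  -- denominator.
  set ε := (η' - η) / (τ * dualNorm N s + 1) with hε
  have hεpos : 0 < ε := div_pos (by linarith) hden
  have hεle : τ * (ε * dualNorm N s) ≤ η' - η := by
    have : ε * (τ * dualNorm N s + 1) = η' - η := div_mul_cancel₀ _ hden.ne'
    linarith
  have hu : ∀ k, (Aᵀ *ᵥ s1) k < (Aᵀ *ᵥ (s1 + ε • s)) k := by
    intro k
    rw [Matrix.mulVec_add, Matrix.mulVec_smul, Pi.add_apply, Pi.smul_apply, smul_eq_mul]
    linarith [mul_pos hεpos (hs k)]
  have hupos : ∀ k, 0 < (Aᵀ *ᵥ (s1 + ε • s)) k := fun k => (hcoord k).1.trans_lt (hu k)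
  have huw : ∀ k, 0 < (Aᵀ *ᵥ (s1 + ε • s)) k - w k := fun k =>
    sub_pos.2 ((hcoord k).2.trans_lt (hu k))
  refine ⟨Aᵀ *ᵥ (s1 + ε • s), w, s1 + ε • s, s2, rfl, by rw [hw, sub_add_cancel], hupos, huw, ?_⟩
  set u := Aᵀ *ᵥ (s1 + ε • s)
  have hzpos : ∀ k, 0 < u k / (u k - w k) := fun k => div_pos (hupos k) (huw k)
  -- Evaluation at the Young maximiser turns the bound into the logarithmic sum.
  have h1 := hbound'
    (fun k => u k / (u k - w k) - Real.log (u k / (u k - w k)) - 1) (fun k => u k / (u k - w k))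
    (mem_expSet_iff.2 ⟨hzpos, fun k => le_rfl⟩)
  have h2 : -∑ k, (u k * Real.log (1 - w k / u k) + w k) ≤
      w ⬝ᵥ ((fun k => u k / (u k - w k)) - 1) - (Aᵀ *ᵥ s1) ⬝ᵥ
        (fun k => u k / (u k - w k) - Real.log (u k / (u k - w k)) - 1) := by
    simp only [dotProduct]
    rw [← Finset.sum_neg_distrib, ← Finset.sum_sub_distrib]
    refine Finset.sum_le_sum fun k _ => ?_
    have e := mul_div_sub_one_eq (hupos k) (huw k)
    have := mul_le_mul_of_nonneg_right (hu k).le (sub_log_sub_one_nonneg (hzpos k))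
    simp only [Pi.sub_apply, Pi.one_apply]
    linarith
  have h3 := mul_le_mul_of_nonneg_left (dualNorm_add_smul_le hN s1 s hεpos.le) hτ
  linarith

/-! ### Convex functions with values in the extended reals -/

theorem exists_coe_eq_of_mem_effDom {m : ℕ} {g : (Fin m → ℝ) → EReal} (hbot : ∀ a, g a ≠ ⊥)
    {a : Fin m → ℝ} (ha : a ∈ effDom g) : ∃ r : ℝ, g a = r :=
  ⟨(g a).toReal, (EReal.coe_toReal (ne_of_lt ha) (hbot a)).symm⟩

theorem IsConvexFun.le_combo {m : ℕ} {g : (Fin m → ℝ) → EReal} (hg : IsConvexFun g)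
    {a b : Fin m → ℝ} {r q : ℝ} (ha : g a ≤ r) (hb : g b ≤ q) {s t : ℝ} (hs : 0 ≤ s)
    (ht : 0 ≤ t) (hst : s + t = 1) :
    g (s • a + t • b) ≤ ((s * r + t * q : ℝ) : EReal) :=
  hg (x := (a, r)) ha (y := (b, q)) hb hs ht hst

theorem IsConvexFun.convexOn_toReal {m : ℕ} {g : (Fin m → ℝ) → EReal} (hg : IsConvexFun g)
    (hbot : ∀ a, g a ≠ ⊥) : ConvexOn ℝ (effDom g) fun a => (g a).toReal := by
  have key : ∀ a ∈ effDom g, ∀ b ∈ effDom g, ∀ s t : ℝ, 0 ≤ s → 0 ≤ t → s + t = 1 →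
      g (s • a + t • b) ≤ ((s * (g a).toReal + t * (g b).toReal : ℝ) : EReal) := by
    intro a ha b hb s t hs ht hst
    exact hg.le_combo (EReal.coe_toReal (ne_of_lt ha) (hbot a)).ge
      (EReal.coe_toReal (ne_of_lt hb) (hbot b)).ge hs ht hst
  refine ⟨fun a ha b hb s t hs ht hst =>
    (key a ha b hb s t hs ht hst).trans_lt (EReal.coe_lt_top _), ?_⟩
  intro a ha b hb s t hs ht hst
  exact EReal.toReal_le_toReal (key a ha b hb s t hs ht hst) (hbot _) (EReal.coe_ne_top _)

/-- A convex function is bounded above near a point of the relative interior of its domain. -/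
theorem IsConvexFun.exists_forall_le_near {m : ℕ} {g : (Fin m → ℝ) → EReal} (hg : IsConvexFun g)
    (hbot : ∀ a, g a ≠ ⊥) {a0 : Fin m → ℝ} (h0 : a0 ∈ intrinsicInterior ℝ (effDom g)) :
    ∃ M : ℝ, ∀ᶠ b in nhds a0, b ∈ affineSpan ℝ (effDom g) → g b ≤ M := by
  obtain ⟨y, hy, rfl⟩ := mem_intrinsicInterior.1 h0
  rw [mem_interior_iff_mem_nhds, Metric.mem_nhds_iff] at hy
  obtain ⟨ε, hε, hball⟩ := hy
  set W := (affineSpan ℝ (effDom g)).direction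
  -- Parametrising the affine span by its direction turns relative interior into interior, where
  -- convex functions are continuous.
  let ι : W →ᵃ[ℝ] (Fin m → ℝ) :=
    W.subtype.toAffineMap + AffineMap.const ℝ W (y : Fin m → ℝ)
  have hι : ∀ w : W, ι w = (w : Fin m → ℝ) + y := fun w => rfl
  have hdom : ∀ w : W, ‖w‖ < ε → ι w ∈ effDom g := by
    intro w hw
    have hmem : ι w ∈ affineSpan ℝ (effDom g) := AffineSubspace.vadd_mem_of_mem_direction w.2 y.2
    have : (⟨ι w, hmem⟩ : affineSpan ℝ (effDom g)) ∈ Metric.ball y ε := by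
      rw [Metric.mem_ball, Subtype.dist_eq, dist_eq_norm]
      simpa [hι] using hw
    exact hball this
  have hconv := (hg.convexOn_toReal hbot).comp_affineMap ι
  have hnhds : ι ⁻¹' effDom g ∈ nhds (0 : W) := by
    filter_upwards [Metric.ball_mem_nhds (0 : W) hε] with w hw
    exact hdom w (by simpa using hw)
  have hM := (hconv.continuousOn_interior.continuousAt
    (interior_mem_nhds.2 hnhds)).eventually_lt continuousAt_const (lt_add_one _)
  obtain ⟨ε', hε', hball'⟩ := Metric.eventually_nhds_iff.1 (hM.and hnhds)
  refine ⟨(g (ι 0)).toReal + 1, ?_⟩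
  filter_upwards [Metric.ball_mem_nhds (y : Fin m → ℝ) hε'] with b hb hbs
  have hw : b - y ∈ W := AffineSubspace.vsub_mem_direction hbs y.2
  have hιb : ι ⟨b - y, hw⟩ = b := by rw [hι]; simp
  have h1 := @hball' ⟨b - y, hw⟩ (by
    rw [Metric.mem_ball, dist_eq_norm] at hb
    rw [dist_zero_right]; exact hb)
  have h2 : b ∈ effDom g := hιb ▸ h1.2
  have h3 := h1.1
  rw [Function.comp_apply, hιb] at h3
  rw [← EReal.coe_toReal (ne_of_lt h2) (hbot b), EReal.coe_le_coe_iff]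
  exact h3.le

/-- A lower bound on a convex set meeting the relative interior of the domain persists for
the closure of the epigraph. -/
theorem IsConvexFun.le_of_mem_closure_epigraph {m : ℕ} {g : (Fin m → ℝ) → EReal}
    (hg : IsConvexFun g) (hbot : ∀ a, g a ≠ ⊥) {a0 : Fin m → ℝ}
    (h0 : a0 ∈ intrinsicInterior ℝ (effDom g)) {Ω : Set (Fin m → ℝ)} (hΩ : Convex ℝ Ω)
    (ha0 : a0 ∈ Ω) {c : ℝ} (hc : ∀ a ∈ Ω, (c : EReal) ≤ g a) {a : Fin m → ℝ} {r : ℝ} (ha : a ∈ Ω)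
    (har : (a, r) ∈ closure {p : (Fin m → ℝ) × ℝ | g p.1 ≤ (p.2 : EReal)}) : c ≤ r := by
  obtain ⟨M, hM⟩ := hg.exists_forall_le_near hbot h0
  obtain ⟨q, hq, hlim⟩ := mem_closure_iff_seq_limit.1 har
  have hlim1 : Filter.Tendsto (fun k => (q k).1) Filter.atTop (nhds a) :=
    (continuous_fst.tendsto _).comp hlim
  have hlim2 : Filter.Tendsto (fun k => (q k).2) Filter.atTop (nhds r) :=
    (continuous_snd.tendsto _).comp hlim
  have hqs : ∀ k, (q k).1 ∈ affineSpan ℝ (effDom g) := fun k =>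
    subset_affineSpan ℝ _ (lt_of_le_of_lt (hq k) (EReal.coe_lt_top _))
  have has : a ∈ affineSpan ℝ (effDom g) :=
    (AffineSubspace.closed_of_finiteDimensional (affineSpan ℝ (effDom g))).mem_of_tendsto hlim1
      (Filter.Eventually.of_forall hqs)
  have ha0s : a0 ∈ affineSpan ℝ (effDom g) :=
    subset_affineSpan ℝ _ (intrinsicInterior_subset h0)
  -- The point `(1 - t) a0 + t a` of `Ω` is rewritten as `(1 - t) b_k + t q_k`, with `b_k → a0` in
  -- the affine span, where `g ≤ M` eventually. Then `k → ∞`, and later `t → 1`.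
  have hstep : ∀ t : ℝ, 0 < t → t < 1 → c ≤ (1 - t) * M + t * r := by
    intro t ht0 ht1
    have ht : 0 < 1 - t := by linarith
    have hb : Filter.Tendsto (fun k => (t / (1 - t)) • (a - (q k).1) + a0) Filter.atTop
        (nhds a0) := by
      have := ((hlim1.const_sub a).const_smul (t / (1 - t))).add_const a0
      simpa using this
    refine ge_of_tendsto ((hlim2.const_mul t).const_add ((1 - t) * M)) ?_
    filter_upwards [hb.eventually hM] with k hk
    have hbs : (t / (1 - t)) • (a - (q k).1) + a0 ∈ affineSpan ℝ (effDom g) :=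
      AffineSubspace.vadd_mem_of_mem_direction
        (Submodule.smul_mem _ _ (AffineSubspace.vsub_mem_direction has (hqs k))) ha0s
    have h1 := hg.le_combo (hk hbs) (hq k) ht.le ht0.le (by ring)
    have e : (1 - t) • ((t / (1 - t)) • (a - (q k).1) + a0) + t • (q k).1 =
        (1 - t) • a0 + t • a := by
      rw [smul_add, smul_smul, mul_div_cancel₀ _ ht.ne', smul_sub]; abel
    rw [e] at h1
    exact EReal.coe_le_coe_iff.1 ((hc _ (hΩ ha0 ha ht.le ht0.le (by ring))).trans h1)
  have hcont : Filter.Tendsto (fun t : ℝ => (1 - t) * M + t * r) (nhdsWithin 1 (Set.Iio 1))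
      (nhds r) := by
    have : Continuous fun t : ℝ => (1 - t) * M + t * r := by fun_prop
    have h := this.tendsto 1
    simp only [sub_self, zero_mul, one_mul, zero_add] at h
    exact h.mono_left nhdsWithin_le_nhds
  refine ge_of_tendsto hcont ?_
  filter_upwards [Ioo_mem_nhdsLT (show (0 : ℝ) < 1 by norm_num)] with t ht
  exact hstep t ht.1 ht.2

/-- Approximate Fenchel duality over a compact convex set. -/
theorem IsConvexFun.exists_affine_minorant {m : ℕ} {g : (Fin m → ℝ) → EReal}
    (hg : IsConvexFun g) (hbot : ∀ a, g a ≠ ⊥) {a0 : Fin m → ℝ}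
    (h0 : a0 ∈ intrinsicInterior ℝ (effDom g)) {Ω : Set (Fin m → ℝ)} (hΩ : Convex ℝ Ω)
    (hΩc : IsCompact Ω) (ha0 : a0 ∈ Ω) {c c' : ℝ} (hcc' : c < c')
    (hc : ∀ a ∈ Ω, (c' : EReal) ≤ g a) :
    ∃ (v : Fin m → ℝ) (α β : ℝ), α < β ∧ (∀ a ∈ Ω, v ⬝ᵥ a + c < α) ∧
      ∀ a (r : ℝ), g a ≤ r → β ≤ v ⬝ᵥ a + r := by
  set E := {p : (Fin m → ℝ) × ℝ | g p.1 ≤ (p.2 : EReal)} with hE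
  have hdisj : Disjoint (Ω ×ˢ {c}) (closure E) := by
    rw [Set.disjoint_left]
    rintro ⟨a, r⟩ ⟨ha, hr⟩ hcl
    obtain rfl : r = c := hr
    exact absurd (hg.le_of_mem_closure_epigraph hbot h0 hΩ ha0 hc ha hcl) (not_le.2 hcc')
  obtain ⟨f, α, β, hf1, hαβ, hf2⟩ := geometric_hahn_banach_compact_closed
    (hΩ.prod (convex_singleton c)) (hΩc.prod isCompact_singleton)
    (Convex.closure (show Convex ℝ E from hg)) isClosed_closure hdisj
  obtain ⟨v, hv⟩ := exists_forall_eq_dotProduct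
    ((f : _ →ₗ[ℝ] ℝ) ∘ₗ LinearMap.inl ℝ (Fin m → ℝ) ℝ)
  set μ : ℝ := f (0, 1) with hμ
  have hf : ∀ a r, f (a, r) = v ⬝ᵥ a + μ * r := by
    intro a r
    rw [← hv]
    have : ((a, r) : (Fin m → ℝ) × ℝ) = (a, 0) + r • (0, 1) := by simp
    rw [this, map_add, map_smul, ← hμ, smul_eq_mul, mul_comm]
    rfl
  have hepi : ∀ a (r : ℝ), g a ≤ r → β < v ⬝ᵥ a + μ * r := by
    intro a r h
    rw [← hf]
    exact hf2 _ (subset_closure h)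
  have hΩf : ∀ a ∈ Ω, v ⬝ᵥ a + μ * c < α := by
    intro a ha
    rw [← hf]
    exact hf1 _ ⟨ha, rfl⟩
  -- Over `a0` lie both the point at height `c` and epigraph points at height at least `c + 1`.
  have hμpos : 0 < μ := by
    obtain ⟨γ, hγ⟩ := exists_coe_eq_of_mem_effDom hbot (intrinsicInterior_subset h0)
    have h1 := hepi a0 (max γ (c + 1)) (by rw [hγ]; exact_mod_cast le_max_left _ _)
    have h2 := hΩf a0 ha0
    have h3 : c + 1 ≤ max γ (c + 1) := le_max_right _ _
    by_contra hle
    push Not at hle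
    nlinarith
  have hinv := inv_pos.2 hμpos
  refine ⟨μ⁻¹ • v, μ⁻¹ * α, μ⁻¹ * β, by gcongr, fun a ha => ?_, fun a r h => ?_⟩
  · have h1 := mul_lt_mul_of_pos_left (hΩf a ha) hinv
    rw [mul_add, inv_mul_cancel_left₀ hμpos.ne'] at h1
    rwa [smul_dotProduct, smul_eq_mul]
  · have h1 := mul_lt_mul_of_pos_left (hepi a r h) hinv
    rw [mul_add, inv_mul_cancel_left₀ hμpos.ne'] at h1
    rw [smul_dotProduct, smul_eq_mul]
    exact h1.le

/-! ### The uncertainty set and the duality of the inner problems -/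

theorem uncertaintySet_eq_image {m : ℕ} (N : Seminorm ℝ (Fin m → ℝ)) (a0 : Fin m → ℝ) (τ δ : ℝ)
    (A V : Matrix (Fin m) (Fin m) ℝ) :
    uncertaintySet N a0 τ δ A V =
      ((Matrix.diagonal a0).mulVecLin ∘ₗ LinearMap.snd ℝ (Fin m → ℝ) (Fin m → ℝ)) ''
        shapeSet N τ δ A V := by
  ext a
  constructor
  · rintro ⟨y, z, h, rfl⟩
    exact ⟨(y, z), h, rfl⟩
  · rintro ⟨⟨y, z⟩, h, rfl⟩
    exact ⟨y, z, h, rfl⟩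

theorem convex_uncertaintySet {m : ℕ} (N : Seminorm ℝ (Fin m → ℝ)) (a0 : Fin m → ℝ) (τ δ : ℝ)
    (A V : Matrix (Fin m) (Fin m) ℝ) : Convex ℝ (uncertaintySet N a0 τ δ A V) := by
  rw [uncertaintySet_eq_image]
  exact (convex_shapeSet N τ δ A V).linear_image _

theorem isCompact_uncertaintySet {m : ℕ} {N : Seminorm ℝ (Fin m → ℝ)} (a0 : Fin m → ℝ) {τ δ : ℝ}
    {A V : Matrix (Fin m) (Fin m) ℝ} (hZ : IsCompact (shapeSet N τ δ A V)) :
    IsCompact (uncertaintySet N a0 τ δ A V) := by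
  rw [uncertaintySet_eq_image]
  exact hZ.image (LinearMap.continuous_of_finiteDimensional _)

theorem center_mem_uncertaintySet {m : ℕ} (N : Seminorm ℝ (Fin m → ℝ)) (a0 : Fin m → ℝ) {τ δ : ℝ}
    (hτ : 0 ≤ τ) (hδ : 0 ≤ δ) (A V : Matrix (Fin m) (Fin m) ℝ) :
    a0 ∈ uncertaintySet N a0 τ δ A V :=
  ⟨0, 1, zero_one_mem_shapeSet N hτ hδ A V, by ext i; simp [Matrix.mulVec_diagonal]⟩

theorem diagonal_mulVec_dotProduct {m : ℕ} (a v z : Fin m → ℝ) :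
    (Matrix.diagonal a *ᵥ v) ⬝ᵥ z = v ⬝ᵥ (Matrix.diagonal a *ᵥ z) := by
  simp only [dotProduct, Matrix.mulVec_diagonal]
  exact Finset.sum_congr rfl fun i _ => by ring

theorem diagonal_mulVec_dotProduct_one {m : ℕ} (a v : Fin m → ℝ) :
    (Matrix.diagonal a *ᵥ v) ⬝ᵥ 1 = a ⬝ᵥ v := by
  simp only [dotProduct, Matrix.mulVec_diagonal, Pi.one_apply, mul_one]

section Duality

variable {m n : ℕ} {f0 : (Fin m → ℝ) → (Fin n → ℝ) → EReal} {N : Seminorm ℝ (Fin m → ℝ)}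
  {a0 : Fin m → ℝ} {τ δ : ℝ} {A V : Matrix (Fin m) (Fin m) ℝ}

/-- Weak duality. -/
theorem dualObjective_le_of_mem (hf_bot : ∀ a x, f0 a x ≠ ⊥) (hN : ∀ y, N y = 0 → y = 0)
    (hτ : 0 ≤ τ) (hδ : 0 ≤ δ) (x : Fin n → ℝ) {d : DualVars m} (hd : d ∈ dualFeasible a0 A V)
    {a : Fin m → ℝ} (ha : a ∈ uncertaintySet N a0 τ δ A V) :
    dualObjective f0 N a0 τ δ x d ≤ f0 a x := by
  rcases eq_or_ne (f0 a x) ⊤ with htop | htop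
  · rw [htop]; exact le_top
  obtain ⟨r, hr⟩ : ∃ r : ℝ, f0 a x = r := ⟨_, (EReal.coe_toReal htop (hf_bot a x)).symm⟩
  obtain ⟨y, z, hyz, rfl⟩ := ha
  obtain ⟨hu, hw, hupos, huw⟩ := hd
  have h1 := dotProduct_le_dual_bound hN hτ hδ (s2 := d.s2) hu hupos huw hyz
  rw [hw, dotProduct_sub, diagonal_mulVec_dotProduct_one, diagonal_mulVec_dotProduct] at h1
  have h2 : (((-d.v) ⬝ᵥ (Matrix.diagonal a0 *ᵥ z) - r : ℝ) : EReal) ≤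
      conjugate (fun a => f0 a x) (-d.v) := by
    rw [EReal.coe_sub, ← hr]
    exact le_iSup₂ (f := fun a (_ : a ∈ effDom fun a => f0 a x) =>
      (((-d.v) ⬝ᵥ a : ℝ) : EReal) - f0 a x) (Matrix.diagonal a0 *ᵥ z) (lt_top_iff_ne_top.2 htop)
  refine (EReal.sub_le_sub le_rfl h2).trans ?_
  rw [← EReal.coe_sub, hr, EReal.coe_le_coe_iff, neg_dotProduct]
  linarith

/-- Strong duality without attainment. -/
theorem exists_le_dualObjective (hf_bot : ∀ a x, f0 a x ≠ ⊥) {x : Fin n → ℝ}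
    (hf_convex : IsConvexFun fun a => f0 a x) (hN : ∀ y, N y = 0 → y = 0)
    (hri : a0 ∈ intrinsicInterior ℝ (effDom fun a => f0 a x)) (hτ : 0 ≤ τ) (hδ : 0 ≤ δ)
    (hZ : IsCompact (shapeSet N τ δ A V)) {c c' : ℝ} (hcc' : c < c')
    (hc : ∀ a ∈ uncertaintySet N a0 τ δ A V, (c' : EReal) ≤ f0 a x) :
    ∃ d ∈ dualFeasible a0 A V, (c : EReal) ≤ dualObjective f0 N a0 τ δ x d := by
  obtain ⟨s, hs⟩ := exists_transpose_mulVec_pos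
    fun y hy hAy => eq_zero_of_isCompact_shapeSet hτ hδ hZ hy hAy
  obtain ⟨v, α, β, hαβ, hΩ, hepi⟩ := hf_convex.exists_affine_minorant (fun a => hf_bot a x) hri
    (convex_uncertaintySet N a0 τ δ A V) (isCompact_uncertaintySet a0 hZ)
    (center_mem_uncertaintySet N a0 hτ hδ A V) hcc' hc
  -- The gap `α < β` of the first separation pays for the perturbation in the second.
  obtain ⟨u, w, s1, s2, hu, hw, hupos, huw, hle⟩ := exists_dual_bound_le hN hτ hδ hs
    (V := V) (p := Matrix.diagonal a0 *ᵥ v) (η := α - c) (η' := β - c)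
    (fun y z hyz => by
      rw [diagonal_mulVec_dotProduct]
      linarith [hΩ _ ⟨y, z, hyz, rfl⟩]) (by linarith)
  refine ⟨⟨u, v, w, s1, s2⟩, ⟨hu, hw, hupos, huw⟩, ?_⟩
  have hconj : conjugate (fun a => f0 a x) (-v) ≤ ((-β : ℝ) : EReal) := by
    refine iSup₂_le fun a ha => ?_
    obtain ⟨r, hr⟩ := exists_coe_eq_of_mem_effDom (fun a => hf_bot a x) ha
    have h1 := hepi a r hr.le
    simp only [hr]
    rw [← EReal.coe_sub, EReal.coe_le_coe_iff, neg_dotProduct]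
    linarith
  refine le_trans ?_ (EReal.sub_le_sub le_rfl hconj)
  rw [← EReal.coe_sub, EReal.coe_le_coe_iff]
  rw [diagonal_mulVec_dotProduct_one] at hle
  simp only
  linarith

theorem worstCase_eq_iSup_dualObjective (hf_bot : ∀ a x, f0 a x ≠ ⊥) {x : Fin n → ℝ}
    (hf_convex : IsConvexFun fun a => f0 a x) (hN : ∀ y, N y = 0 → y = 0)
    (hri : a0 ∈ intrinsicInterior ℝ (effDom fun a => f0 a x)) (hτ : 0 ≤ τ) (hδ : 0 ≤ δ)
    (hZ : IsCompact (shapeSet N τ δ A V)) :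
    worstCase f0 (uncertaintySet N a0 τ δ A V) x =
      ⨆ d ∈ dualFeasible a0 A V, dualObjective f0 N a0 τ δ x d := by
  refine le_antisymm ?_
    (iSup₂_le fun d hd => le_iInf₂ fun a ha => dualObjective_le_of_mem hf_bot hN hτ hδ x hd ha)
  by_contra hlt
  push Not at hlt
  obtain ⟨c, h1, h2⟩ := EReal.lt_iff_exists_real_btwn.1 hlt
  -- A second real is needed because strict separation of the epigraph consumes the gap `c < c'`.
  obtain ⟨c', h3, h4⟩ := EReal.lt_iff_exists_real_btwn.1 h2
  obtain ⟨d, hd, hle⟩ := exists_le_dualObjective hf_bot hf_convex hN hri hτ hδ hZ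
    (EReal.coe_lt_coe_iff.1 h3) (fun a ha => h4.le.trans (iInf₂_le a ha))
  exact absurd (hle.trans (le_iSup₂ (f := fun d (_ : d ∈ dualFeasible a0 A V) =>
    dualObjective f0 N a0 τ δ x d) d hd)) (not_le.2 h1)

theorem exists_eq_worstCase (hf_bot : ∀ a x, f0 a x ≠ ⊥) {x : Fin n → ℝ}
    (hf_convex : IsConvexFun fun a => f0 a x) (hfin : ∀ a, f0 a x ≠ ⊤) {Ω : Set (Fin m → ℝ)}
    (hΩ : IsCompact Ω) (hne : Ω.Nonempty) : ∃ a ∈ Ω, f0 a x = worstCase f0 Ω x := by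
  have hdom : effDom (fun a => f0 a x) = Set.univ :=
    Set.eq_univ_of_forall fun a => lt_top_iff_ne_top.2 (hfin a)
  have hconv := hf_convex.convexOn_toReal fun a => hf_bot a x
  rw [hdom] at hconv
  obtain ⟨a, ha, hmin⟩ := hΩ.exists_isMinOn hne hconv.locallyLipschitz.continuous.continuousOn
  refine ⟨a, ha, le_antisymm (le_iInf₂ fun b hb => ?_) (iInf₂_le a ha)⟩
  rw [← EReal.coe_toReal (hfin a) (hf_bot a x), ← EReal.coe_toReal (hfin b) (hf_bot b x),
    EReal.coe_le_coe_iff]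
  exact hmin hb

end Duality

/-! ### Optimal solutions -/

theorem isOptimal_iff_eq_iSup {α : Type*} {F : α → EReal} {C : Set α} {p : α} :
    IsOptimal F C p ↔ p ∈ C ∧ F p = ⨆ q ∈ C, F q := by
  refine and_congr_right fun hp => ⟨fun h => ?_, fun h q hq => ?_⟩
  · exact le_antisymm (le_iSup₂ (f := fun q (_ : q ∈ C) => F q) p hp) (iSup₂_le h)
  · rw [h]
    exact le_iSup₂ (f := fun q (_ : q ∈ C) => F q) q hq

theorem isOptimal_prod_iff {α β : Type*} {Φ : α → EReal} {Ψ : α → β → EReal} {S : Set α}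
    {D : Set β} (h : ∀ x, Φ x = ⨆ d ∈ D, Ψ x d) (x : α) (d : β) :
    IsOptimal (fun p : α × β => Ψ p.1 p.2) (S ×ˢ D) (x, d) ↔
      IsOptimal Φ S x ∧ d ∈ D ∧ Ψ x d = Φ x := by
  have hle : ∀ x, ∀ d ∈ D, Ψ x d ≤ Φ x := fun x d hd => by
    rw [h]
    exact le_iSup₂ (f := fun d (_ : d ∈ D) => Ψ x d) d hd
  constructor
  · rintro ⟨⟨hx, hd⟩, hopt⟩
    have hub : ∀ x' ∈ S, Φ x' ≤ Ψ x d := fun x' hx' => by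
      rw [h]
      exact iSup₂_le fun d' hd' => hopt (x', d') ⟨hx', hd'⟩
    exact ⟨⟨hx, fun x' hx' => (hub x' hx').trans (hle x d hd)⟩, hd,
      le_antisymm (hle x d hd) (hub x hx)⟩
  · rintro ⟨⟨hx, hopt⟩, hd, heq⟩
    refine ⟨⟨hx, hd⟩, ?_⟩
    rintro ⟨x', d'⟩ ⟨hx', hd'⟩
    exact (hle x' d' hd').trans ((hopt x' hx').trans heq.ge)

end RobustPos

theorem mainTheorem6 {m n : ℕ}
    (f0 : (Fin m → ℝ) → (Fin n → ℝ) → EReal) (hf_bot : ∀ a x, f0 a x ≠ ⊥)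
    (hf_convex : ∀ x, IsConvexFun (fun a => f0 a x))
    (N : Seminorm ℝ (Fin m → ℝ)) (hN : ∀ y, N y = 0 → y = 0)
    (a0 : Fin m → ℝ) (ha0 : ∀ i, 0 < a0 i)
    (hri : ∀ x, a0 ∈ intrinsicInterior ℝ (effDom (fun a => f0 a x)))
    (τ δ : ℝ) (hτ : 0 ≤ τ) (hδ : 0 ≤ δ) (A V : Matrix (Fin m) (Fin m) ℝ)
    (hZ : IsCompact (shapeSet N τ δ A V))
    (S : Set (Fin n → ℝ)) :
    -- for every `x`, the inner infimum equals the supremum over the auxiliary variables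
    (∀ x, worstCase f0 (uncertaintySet N a0 τ δ A V) x =
      ⨆ d ∈ dualFeasible a0 A V, dualObjective f0 N a0 τ δ x d) ∧
    -- the two problems have the same optimal value
    (⨆ x ∈ S, worstCase f0 (uncertaintySet N a0 τ δ A V) x) =
      (⨆ p ∈ S ×ˢ dualFeasible a0 A V, dualObjective f0 N a0 τ δ p.1 p.2) ∧
    -- optimal solutions of the robust problem, read off from the dual problem
    (∀ x, IsOptimal (worstCase f0 (uncertaintySet N a0 τ δ A V)) S x ↔
      x ∈ S ∧ (⨆ d ∈ dualFeasible a0 A V, dualObjective f0 N a0 τ δ x d) =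
        ⨆ p ∈ S ×ˢ dualFeasible a0 A V, dualObjective f0 N a0 τ δ p.1 p.2) ∧
    -- optimal solutions of the dual problem, read off from the robust problem
    (∀ x d, IsOptimal (fun p => dualObjective f0 N a0 τ δ p.1 p.2)
        (S ×ˢ dualFeasible a0 A V) (x, d) ↔
      IsOptimal (worstCase f0 (uncertaintySet N a0 τ δ A V)) S x ∧ d ∈ dualFeasible a0 A V ∧
        dualObjective f0 N a0 τ δ x d = worstCase f0 (uncertaintySet N a0 τ δ A V) x) ∧
    -- the inner infimum is a minimum wherever `f0 (·, x)` is finite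
    (∀ x, (∀ a, f0 a x ≠ ⊤) → ∃ a ∈ uncertaintySet N a0 τ δ A V,
      f0 a x = worstCase f0 (uncertaintySet N a0 τ δ A V) x) := by
  have hdual : ∀ x, worstCase f0 (uncertaintySet N a0 τ δ A V) x =
      ⨆ d ∈ dualFeasible a0 A V, dualObjective f0 N a0 τ δ x d := fun x =>
    worstCase_eq_iSup_dualObjective hf_bot (hf_convex x) hN (hri x) hτ hδ hZ
  have hvalue : (⨆ x ∈ S, worstCase f0 (uncertaintySet N a0 τ δ A V) x) =
      ⨆ p ∈ S ×ˢ dualFeasible a0 A V, dualObjective f0 N a0 τ δ p.1 p.2 := by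
    simp only [hdual]
    exact (biSup_prod (f := fun p : (Fin n → ℝ) × DualVars m =>
      dualObjective f0 N a0 τ δ p.1 p.2)).symm
  refine ⟨hdual, hvalue, fun x => ?_, isOptimal_prod_iff hdual, fun x hfin => ?_⟩
  · rw [isOptimal_iff_eq_iSup, hvalue, hdual]
  · exact exists_eq_worstCase hf_bot (hf_convex x) hfin (isCompact_uncertaintySet a0 hZ)
      ⟨a0, center_mem_uncertaintySet N a0 hτ hδ A V⟩
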